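/- Let $n \ge 2$. Let $B_n = ([n]\times[n]) \cup \{\vartheta\}$ be the Brandt semigroup, written additively: $(i,j)+(k,l) = (i,l)$ if $j=k$, and all other sums are $\vartheta$. Let $\mathrm{Aff}(B_n)$ be the set of affine maps on $B_n$, that is, the pointwise sums of an endomorphism of $B_n$ and a constant map, and let $A^+(B_n)$ be the affine near-semiring over $B_n$, that is, the smallest set of maps $B_n \to B_n$ that contains $\mathrm{Aff}(B_n)$ and is closed under pointwise addition and composition. Let $\Sigma = \mathrm{Aff}(B_n)$, regarded as a finite alphabet, let $\Sigma^*$ be the set of all words over $\Sigma$ and $\Sigma^+$ the free semigroup of nonempty words over $\Sigma$. Let $P$ be the set of maps $B_n\to B_n$ that consists of the constant map with value $(1,2)$ and, for all $k,l\in[n]$, of the map that sends $(k,l)$ to $(1,1)$ and every other element to $\vartheta$. Put $$L = \{\, f_1 f_2\cdots f_m \in \Sigma^+ \;:\; f_1+f_2+\cdots+f_m \in P \,\}.$$ Then: (a) the additive semigroup $(A^+(B_n),+)$ is isomorphic to the syntactic semigroup of $L$, that is, to the quotient of $\Sigma^+$ by the congruence $\approx_L$, where $x\approx_L y$ if and only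 if, for all $u,v\in\Sigma^+$, $uxv\in L \Leftrightarrow uyv\in L$; (b) $L$ is star-free, that is, $L$ can be obtained from $\varnothing$, $\{\varepsilon\}$ and the languages $\{a\}$ with $a\in\Sigma$ by finitely many unions, concatenations and complements in $\Sigma^*$. In particular, $(A^+(B_n),+)$ is the syntactic semigroup of a star-free language. -/

import Mathlib

/-! ### Syntactic semigroups and star-free languages -/

/-- The syntactic congruence of a subset `D` of a semigroup `S`: `x` and `y` are related iff
`u x v ∈ D ↔ u y v ∈ D` for all `u, v ∈ S`. -/
def syntacticCon {S : Type*} [Semigroup S] (D : Set S) : Con S where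
  r x y := ∀ u v : S, u * x * v ∈ D ↔ u * y * v ∈ D
  iseqv :=
    { refl := fun _ _ _ => Iff.rfl
      symm := fun h u v => (h u v).symm
      trans := fun h k u v => (h u v).trans (k u v) }
  mul' := by
    intro w x y z h k u v
    have h1 := h u (y * v)
    have h2 := k (u * x) v
    simp only [mul_assoc] at h1 h2 ⊢
    exact h1.trans h2

/-- The syntactic semigroup of a language `L ⊆ Σ⁺`, where `Σ⁺` is the free semigroup on the
alphabet: the quotient of `Σ⁺` by the syntactic congruence of `L`. -/
abbrev SyntacticSemigroup {α : Type*} (L : Set (FreeSemigroup α)) : Type _ :=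
  (syntacticCon L).Quotient

/-- A subset of `Σ⁺` regarded as a language, i.e. as a set of words of `Σ*`. -/
def toLanguage {α : Type*} (L : Set (FreeSemigroup α)) : Language α :=
  {w : List α | ∃ x ∈ L, w = x.head :: x.tail}

/-- Star-free expressions over an alphabet. -/
inductive StarFreeExpr (α : Type*) where
  | empty : StarFreeExpr α
  | epsilon : StarFreeExpr α
  | letter (a : α) : StarFreeExpr α
  | union (r s : StarFreeExpr α) : StarFreeExpr α
  | concat (r s : StarFreeExpr α) : StarFreeExpr α
  | compl (r : StarFreeExpr α) : StarFreeExpr α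

/-- The language represented by a star-free expression; complements are taken in `Σ*`. -/
def StarFreeExpr.lang {α : Type*} : StarFreeExpr α → Language α
  | .empty => {_w : List α | False}
  | .epsilon => {w : List α | w = []}
  | .letter a => {w : List α | w = [a]}
  | .union r s => {w : List α | w ∈ r.lang ∨ w ∈ s.lang}
  | .concat r s => {w : List α | ∃ u ∈ r.lang, ∃ v ∈ s.lang, u ++ v = w}
  | .compl r => {w : List α | w ∉ r.lang}

/-- A language is star-free if it is represented by a star-free expression. -/
def IsStarFree {α : Type*} (L : Language α) : Prop :=
  ∃ r : StarFreeExpr α, r.lang = L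

/-! ### The affine near-semiring over a semigroup -/

/-- The set `Aff(S)` of affine maps: pointwise sums of an endomorphism and a constant map. -/
def Aff (S : Type*) [AddSemigroup S] : Set (S → S) :=
  {f | ∃ (g : S →ₙ+ S) (c : S), f = fun x => g x + c}

/-- Membership in the subset of `S → S` generated by `Aff(S)` under pointwise addition and
composition of maps. -/
inductive IsAffineGenerated (S : Type*) [AddSemigroup S] : (S → S) → Prop where
  | of_aff (f : S → S) (hf : f ∈ Aff S) : IsAffineGenerated S f
  | add (f g : S → S) (hf : IsAffineGenerated S f) (hg : IsAffineGenerated S g) :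
      IsAffineGenerated S (f + g)
  | comp (f g : S → S) (hf : IsAffineGenerated S f) (hg : IsAffineGenerated S g) :
      IsAffineGenerated S (g ∘ f)

/-- The additive semigroup reduct of the affine near-semiring `A⁺(S)`, the subnear-semiring of
`(S → S, +, ∘)` generated by `Aff(S)`. -/
def affineNearSemiringAdd (S : Type*) [AddSemigroup S] : AddSubsemigroup (S → S) where
  carrier := {f | IsAffineGenerated S f}
  add_mem' := fun {f g} hf hg => IsAffineGenerated.add f g hf hg

/-- The sum `f₁ + ⋯ + f_k` of a nonempty word `f₁ ⋯ f_k` over `Aff(S)`: the extension of the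
inclusion of the letters to a homomorphism from the free semigroup to `(S → S, +)`. -/
def wordSum {S : Type*} [AddSemigroup S] (x : FreeSemigroup (Aff S)) : S → S :=
  Multiplicative.toAdd
    (FreeSemigroup.lift (fun f : Aff S => Multiplicative.ofAdd (f : S → S)) x)

/-! ### Brandt semigroups -/

/-- The underlying set of the Brandt semigroup `B_n`: all pairs of elements of an `n`-element
set, and a zero element. The indices `1, …, n` are represented by `0, …, n - 1`. -/
inductive Brandt (n : ℕ) where
  | zero : Brandt n
  | pair (i j : Fin n) : Brandt n
deriving DecidableEq, Fintype

namespace Brandt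

/-- The operation of the Brandt semigroup. -/
protected def add {n : ℕ} : Brandt n → Brandt n → Brandt n
  | pair i j, pair k l => if j = k then pair i l else zero
  | _, _ => zero

instance (n : ℕ) : AddSemigroup (Brandt n) where
  add := Brandt.add
  add_assoc a b c := by
    change Brandt.add (Brandt.add a b) c = Brandt.add a (Brandt.add b c)
    rcases a with _ | ⟨i, j⟩ <;> rcases b with _ | ⟨k, l⟩ <;> rcases c with _ | ⟨p, q⟩ <;>
      simp only [Brandt.add] <;> split_ifs <;> simp_all

/-- The map on `B_n` that sends `a` to `b` and every other element to the zero element. -/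
def single {n : ℕ} (a b : Brandt n) : Brandt n → Brandt n :=
  fun x => if x = a then b else zero

/-- The set `P`: the constant map with value `(1, 2)`, and all the singleton support maps that
send some `(k, l)` to `(1, 1)`. -/
def targetSet (n : ℕ) (hn : 2 ≤ n) : Set (Brandt n → Brandt n) :=
  let one : Fin n := ⟨0, by omega⟩
  let two : Fin n := ⟨1, by omega⟩
  {fun _ => pair one two} ∪ {f | ∃ k l : Fin n, f = single (pair k l) (pair one one)}

/-- The language of all nonempty words over `Aff(B_n)` whose sum lies in `P`. -/
def sumLanguage (n : ℕ) (hn : 2 ≤ n) : Set (FreeSemigroup (Aff (Brandt n))) :=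
  {x | wordSum x ∈ targetSet n hn}

end Brandt

/-! ### Closure properties of star-free languages -/

namespace IsStarFree

variable {α : Type*}

/-! Constant maps are affine, so every element of the near-semiring is a sum of affine maps. Part
(a) then says that the syntactic congruence is equality of sums. Membership in `L` depends only on
the sum; conversely, any nonzero value of a sum can be detected by multiplying with suitable words
on both sides and testing membership in `P` (`wordSum_apply_eq_of_syntacticCon`). For (b), a sum in
a Brandt semigroup is nonzero iff all adjacent summands match, and its value is then read off the
first and last terms. Prescribing a nonzero value at a point is therefore a condition on the first
letter, the last letter and the factors of length two (`wordSum_apply_eq_pair_iff`), and `L` is a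
finite Boolean combination of such conditions. -/

theorem empty : IsStarFree ({_w : List α | False} : Language α) := ⟨.empty, rfl⟩

theorem letter (a : α) : IsStarFree ({w : List α | w = [a]} : Language α) := ⟨.letter a, rfl⟩

theorem compl {L : Set (List α)} (h : IsStarFree (L : Language α)) :
    IsStarFree ({w | w ∉ L} : Set (List α)) := by
  obtain ⟨r, rfl⟩ := h
  exact ⟨.compl r, rfl⟩

theorem union {L M : Set (List α)} (h : IsStarFree (L : Language α))
    (k : IsStarFree (M : Language α)) : IsStarFree ({w | w ∈ L ∨ w ∈ M} : Set (List α)) := by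
  obtain ⟨r, rfl⟩ := h
  obtain ⟨s, rfl⟩ := k
  exact ⟨.union r s, rfl⟩

theorem concat {L M : Set (List α)} (h : IsStarFree (L : Language α))
    (k : IsStarFree (M : Language α)) :
    IsStarFree ({w | ∃ u ∈ L, ∃ v ∈ M, u ++ v = w} : Set (List α)) := by
  obtain ⟨r, rfl⟩ := h
  obtain ⟨s, rfl⟩ := k
  exact ⟨.concat r s, rfl⟩

theorem congr {L M : Set (List α)} (h : IsStarFree (L : Language α)) (e : ∀ w, w ∈ L ↔ w ∈ M) :
    IsStarFree (M : Language α) := by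
  rwa [← Set.ext e]

theorem inter {L M : Set (List α)} (h : IsStarFree (L : Language α))
    (k : IsStarFree (M : Language α)) : IsStarFree ({w | w ∈ L ∧ w ∈ M} : Set (List α)) :=
  (h.compl.union k.compl).compl.congr fun w => by
    simp only [Set.mem_ofPred_eq]; tauto

theorem univ : IsStarFree ({_w : List α | True} : Set (List α)) :=
  empty.compl.congr fun _ => by simp

theorem iUnion {ι : Type*} [Finite ι] {L : ι → Set (List α)}
    (h : ∀ i, IsStarFree (L i : Language α)) : IsStarFree ({w | ∃ i, w ∈ L i} : Set (List α)) := by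
  classical
  cases nonempty_fintype ι
  suffices ∀ s : Finset ι, IsStarFree ({w | ∃ i ∈ s, w ∈ L i} : Set (List α)) from
    (this Finset.univ).congr fun w => by simp
  intro s
  induction s using Finset.induction_on with
  | empty => exact empty.congr fun w => by simp
  | insert i s _ ih => exact ((h i).union ih).congr fun w => by simp

theorem iInter {ι : Type*} [Finite ι] {L : ι → Set (List α)}
    (h : ∀ i, IsStarFree (L i : Language α)) : IsStarFree ({w | ∀ i, w ∈ L i} : Set (List α)) :=
  (iUnion fun i => (h i).compl).compl.congr fun w => by simp

theorem nonempty [Finite α] : IsStarFree ({w | w ≠ []} : Set (List α)) :=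
  (iUnion fun a : α => (letter a).concat univ).congr fun w => by
    cases w <;> simp

theorem head [Finite α] (Q : α → Prop) :
    IsStarFree ({w | ∃ a t, w = a :: t ∧ Q a} : Set (List α)) :=
  (iUnion fun a : {a // Q a} => (letter a.1).concat univ).congr fun w => by
    simp only [Set.mem_ofPred_eq, Subtype.exists]
    constructor
    · rintro ⟨a, ha, _, rfl, t, -, rfl⟩
      exact ⟨a, t, rfl, ha⟩
    · rintro ⟨a, t, rfl, ha⟩
      exact ⟨a, ha, _, rfl, t, trivial, rfl⟩

theorem last [Finite α] (Q : α → Prop) :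
    IsStarFree ({w | ∃ t a, w = t ++ [a] ∧ Q a} : Set (List α)) :=
  (iUnion fun a : {a // Q a} => univ.concat (letter a.1)).congr fun w => by
    simp only [Set.mem_ofPred_eq, Subtype.exists]
    constructor
    · rintro ⟨a, ha, t, -, _, rfl, rfl⟩
      exact ⟨t, a, rfl, ha⟩
    · rintro ⟨t, a, rfl, ha⟩
      exact ⟨a, ha, t, trivial, _, rfl, rfl⟩

/-- Complement of the finite union of `Σ* a b Σ*` over the forbidden pairs `a, b`. -/
theorem isChain [Finite α] (R : α → α → Prop) :
    IsStarFree ({w | w.IsChain R} : Set (List α)) :=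
  (iUnion fun p : {p : α × α // ¬ R p.1 p.2} =>
    univ.concat ((letter p.1.1).concat ((letter p.1.2).concat univ))).compl.congr fun w => by
    simp only [Set.mem_ofPred_eq, Subtype.exists, Prod.exists,
      List.isChain_iff_forall_rel_of_append_cons_cons]
    constructor
    · intro h a b u v hw
      by_contra hR
      exact h ⟨a, b, hR, u, trivial, _, ⟨_, rfl, _, ⟨_, rfl, v, trivial, rfl⟩, rfl⟩, hw.symm⟩
    · rintro h ⟨a, b, hR, u, -, _, ⟨_, rfl, _, ⟨_, rfl, v, -, rfl⟩, rfl⟩, rfl⟩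
      exact hR (h rfl)

end IsStarFree

/-! ### Sums of words of affine maps -/

section WordSum

variable {S : Type*} [AddSemigroup S]

theorem wordSum_of (f : Aff S) : wordSum (FreeSemigroup.of f) = f := rfl

theorem wordSum_mul (x y : FreeSemigroup (Aff S)) : wordSum (x * y) = wordSum x + wordSum y := by
  simp [wordSum]

theorem isAffineGenerated_wordSum (x : FreeSemigroup (Aff S)) : IsAffineGenerated S (wordSum x) := by
  induction x using FreeSemigroup.recOnMul with
  | ih1 f => exact .of_aff _ f.2
  | ih2 f y hf hy => rw [wordSum_mul]; exact .add _ _ hf hy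

theorem exists_wordSum_eq_endomorphism_comp (g : S →ₙ+ S) (x : FreeSemigroup (Aff S)) :
    ∃ y, wordSum y = g ∘ wordSum x := by
  induction x using FreeSemigroup.recOnMul with
  | ih1 f =>
    obtain ⟨f, h, c, rfl⟩ := f
    exact ⟨.of ⟨_, g.comp h, g c, rfl⟩, by ext y; simp [wordSum_of]⟩
  | ih2 f y hf hy =>
    obtain ⟨u, hu⟩ := hf
    obtain ⟨v, hv⟩ := hy
    exact ⟨u * v, by ext y; simp [wordSum_mul, hu, hv]⟩

/-- If constant maps are affine, every element of the affine near-semiring is a sum of affine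
maps: composing an affine map with a sum only requires distributing its endomorphism part. -/
theorem IsAffineGenerated.exists_wordSum_eq (hS : ∀ c : S, (fun _ => c) ∈ Aff S) {f : S → S}
    (hf : IsAffineGenerated S f) : ∃ x, wordSum x = f := by
  induction hf with
  | of_aff f hf => exact ⟨.of ⟨f, hf⟩, rfl⟩
  | add f g _ _ ihf ihg =>
    obtain ⟨x, rfl⟩ := ihf
    obtain ⟨y, rfl⟩ := ihg
    exact ⟨x * y, wordSum_mul x y⟩
  | comp f g _ _ ihf ihg =>
    obtain ⟨x, rfl⟩ := ihf
    obtain ⟨y, rfl⟩ := ihg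
    induction y using FreeSemigroup.recOnMul with
    | ih1 a =>
      obtain ⟨a, g, c, rfl⟩ := a
      obtain ⟨z, hz⟩ := exists_wordSum_eq_endomorphism_comp g x
      -- The constant part of the outer map becomes a letter of its own.
      exact ⟨z * .of ⟨_, hS c⟩, by ext y; simp [wordSum_mul, hz, wordSum_of]⟩
    | ih2 a y iha ihy =>
      obtain ⟨u, hu⟩ := iha (.of_aff _ a.2)
      obtain ⟨v, hv⟩ := ihy (isAffineGenerated_wordSum y)
      exact ⟨u * v, by ext y; simp [wordSum_mul, hu, hv]⟩

/-- If the syntactic congruence of `L` identifies exactly the words with equal sums, the syntactic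
semigroup of `L` is the additive semigroup of the affine near-semiring. -/
noncomputable def syntacticSemigroupEquiv (hS : ∀ c : S, (fun _ => c) ∈ Aff S)
    (L : Set (FreeSemigroup (Aff S)))
    (hL : ∀ x y, syntacticCon L x y ↔ wordSum x = wordSum y) :
    SyntacticSemigroup L ≃* Multiplicative (affineNearSemiringAdd S) :=
  MulEquiv.ofBijective
    (⟨fun q => Con.liftOn q
        (fun x => Multiplicative.ofAdd
          (⟨wordSum x, isAffineGenerated_wordSum x⟩ : affineNearSemiringAdd S))
        fun x y h => congrArg Multiplicative.ofAdd (Subtype.ext ((hL x y).1 h)),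
      by
        rintro ⟨x⟩ ⟨y⟩
        exact congrArg Multiplicative.ofAdd (Subtype.ext (wordSum_mul x y))⟩ :
      SyntacticSemigroup L →ₙ* Multiplicative (affineNearSemiringAdd S))
    ⟨by
      rintro ⟨x⟩ ⟨y⟩ h
      exact (Con.eq _).2 ((hL x y).2 (congrArg (fun z => (Multiplicative.toAdd z).1) h)),
     by
      rintro ⟨f, hf⟩
      obtain ⟨x, rfl⟩ := IsAffineGenerated.exists_wordSum_eq hS hf
      exact ⟨(x : SyntacticSemigroup L), rfl⟩⟩

end WordSum

/-! ### Affine maps on Brandt semigroups -/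

namespace Brandt

variable {n : ℕ}

@[simp] theorem zero_add (a : Brandt n) : zero + a = zero := rfl

@[simp] theorem add_zero (a : Brandt n) : a + zero = zero := by cases a <;> rfl

@[simp] theorem pair_add_pair (i j k l : Fin n) :
    pair i j + pair k l = if j = k then pair i l else zero := rfl

theorem add_eq_pair_iff {a b : Brandt n} {p q : Fin n} :
    a + b = pair p q ↔ ∃ j, a = pair p j ∧ b = pair j q := by
  rcases a with _ | ⟨i, j⟩ <;> rcases b with _ | ⟨k, l⟩ <;> simp
  grind

theorem add_ne_zero_iff {a b : Brandt n} :
    a + b ≠ zero ↔ ∃ i j k, a = pair i j ∧ b = pair j k := by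
  rcases a with _ | ⟨i, j⟩ <;> rcases b with _ | ⟨k, l⟩ <;> simp

theorem const_mem_Aff (c : Brandt n) : (fun _ => c) ∈ Aff (Brandt n) := by
  rcases c with _ | ⟨i, j⟩
  · exact ⟨⟨fun _ => zero, fun _ _ => rfl⟩, zero, rfl⟩
  · exact ⟨⟨fun _ => pair i i, fun _ _ => by simp⟩, pair i j, by simp⟩

/-- An affine map that does not fix the zero element is constant. -/
theorem eq_const_of_mem_Aff {f : Brandt n → Brandt n} (hf : f ∈ Aff (Brandt n))
    (h : f zero ≠ zero) (x : Brandt n) : f x = f zero := by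
  obtain ⟨g, c, rfl⟩ := hf
  dsimp only at h ⊢
  -- The image `g zero` absorbs `g x` on both sides; if it is a pair, this forces `g x = g zero`.
  have hx : g zero + g x = g zero := by rw [← map_add, zero_add]
  have hx' : g x + g zero = g zero := by rw [← map_add, add_zero]
  congr 1
  revert h hx hx'
  generalize g zero = a
  generalize g x = b
  rcases a with _ | ⟨i, j⟩ <;> rcases b with _ | ⟨k, l⟩ <;> simp
  grind

/-- A sum that is nonzero at `zero` has all its summands nonzero there, so every letter is constant.
-/
theorem wordSum_eq_const (w : FreeSemigroup (Aff (Brandt n))) (h : wordSum w zero ≠ zero)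
    (x : Brandt n) : wordSum w x = wordSum w zero := by
  induction w using FreeSemigroup.recOnMul with
  | ih1 f => exact eq_const_of_mem_Aff f.2 h x
  | ih2 f y hf hy =>
    simp only [wordSum_mul, Pi.add_apply] at h ⊢
    rw [hf, hy]
    · rintro e; simp [e] at h
    · rintro e; simp [e] at h

theorem exists_wordSum_eq_single (k l p r : Fin n) :
    ∃ w : FreeSemigroup (Aff (Brandt n)), wordSum w = single (pair k l) (pair p r) := by
  -- `(p,k) + x + (l,r)` is nonzero only for `x = (k,l)`.
  refine ⟨.of ⟨_, const_mem_Aff (pair p k)⟩ * .of ⟨_, AddHom.id _, pair l r, rfl⟩, ?_⟩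
  ext x
  rcases x with _ | ⟨i, j⟩
  · simp [wordSum_mul, wordSum_of, single]
  · simp only [wordSum_mul, wordSum_of, Pi.add_apply, AddHom.id_apply, pair_add_pair, single,
      pair.injEq]
    grind [pair_add_pair, add_zero]

/-! ### The syntactic congruence -/

/-- The target set separates the sums of words, under translations by sums of words. -/
theorem wordSum_apply_eq_of_syntacticCon (hn : 2 ≤ n) {x y : FreeSemigroup (Aff (Brandt n))}
    (h : syntacticCon (sumLanguage n hn) x y) {a : Brandt n} {p q : Fin n}
    (hx : wordSum x a = pair p q) : wordSum y a = pair p q := by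
  set i₁ : Fin n := ⟨0, by omega⟩ with hi₁
  set i₂ : Fin n := ⟨1, by omega⟩ with hi₂
  have h₁₂ : i₁ ≠ i₂ := by simp [hi₁, hi₂]
  rcases a with _ | ⟨k, l⟩
  · let u : FreeSemigroup (Aff (Brandt n)) := .of ⟨_, const_mem_Aff (pair i₁ p)⟩
    let v : FreeSemigroup (Aff (Brandt n)) := .of ⟨_, const_mem_Aff (pair q i₂)⟩
    have hc : wordSum x = fun _ => pair p q := by
      ext b
      rw [wordSum_eq_const x (by simp [hx]), hx]
    have hx' : u * x * v ∈ sumLanguage n hn := by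
      left
      ext b
      simp [u, v, wordSum_mul, wordSum_of, hc, hi₁, hi₂]
    have hy : wordSum (u * y * v) ∈ targetSet n hn := (h u v).1 hx'
    rcases hy with hy | ⟨k, l, hy⟩
    -- The context forces all nonzero values to be `(1,2)`, so the singleton maps, with value
    -- `(1,1)`, are excluded below.
    · have := congrFun hy zero
      simp only [u, v, wordSum_mul, wordSum_of, Pi.add_apply, add_eq_pair_iff] at this
      grind
    · have := congrFun hy (pair k l)
      simp only [u, v, wordSum_mul, wordSum_of, Pi.add_apply, single, if_true,
        add_eq_pair_iff] at this
      grind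
  · obtain ⟨u, hu⟩ := exists_wordSum_eq_single k l i₁ p
    obtain ⟨v, hv⟩ := exists_wordSum_eq_single k l q i₁
    have hx' : u * x * v ∈ sumLanguage n hn := by
      right
      refine ⟨k, l, ?_⟩
      ext b
      by_cases hb : b = pair k l <;> simp [wordSum_mul, hu, hv, single, hb, hx, hi₁]
    have hy : wordSum (u * y * v) ∈ targetSet n hn := (h u v).1 hx'
    -- Every map in `P` is nonzero somewhere; the two outer factors vanish off `(k,l)`, so that
    -- point is `(k,l)`.
    obtain ⟨b, i, j, hb⟩ : ∃ b i j, wordSum (u * y * v) b = pair i j := by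
      rcases hy with hy | ⟨k, l, hy⟩
      · exact ⟨zero, _, _, congrFun hy zero⟩
      · exact ⟨pair k l, _, _, by rw [hy]; simp only [single, if_true]; rfl⟩
    simp only [wordSum_mul, hu, hv, Pi.add_apply, add_eq_pair_iff, single] at hb
    grind

theorem syntacticCon_sumLanguage_iff (hn : 2 ≤ n) (x y : FreeSemigroup (Aff (Brandt n))) :
    syntacticCon (sumLanguage n hn) x y ↔ wordSum x = wordSum y := by
  constructor
  · intro h
    ext a
    rcases hx : wordSum x a with _ | ⟨p, q⟩
    · rcases hy : wordSum y a with _ | ⟨p, q⟩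
      · rfl
      · rw [← hx, wordSum_apply_eq_of_syntacticCon hn ((syntacticCon _).symm h) hy]
    · rw [wordSum_apply_eq_of_syntacticCon hn h hx]
  · intro h u v
    simp only [sumLanguage, Set.mem_ofPred_eq, wordSum_mul, h]

/-! ### Star-freeness -/

theorem wordSum_apply_eq_pair_iff (x : FreeSemigroup (Aff (Brandt n))) (a : Brandt n)
    (p q : Fin n) :
    wordSum x a = pair p q ↔
      (∃ j, x.head.1 a = pair p j) ∧
      (∃ t f, x.head :: x.tail = t ++ [f] ∧ ∃ i, f.1 a = pair i q) ∧
      (x.head :: x.tail).IsChain (fun f g => f.1 a + g.1 a ≠ zero) := by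
  induction x using FreeSemigroup.recOnMul generalizing p with
  | ih1 f =>
    simp only [wordSum_of, FreeSemigroup.of_head, FreeSemigroup.of_tail]
    constructor
    · intro h
      exact ⟨⟨_, h⟩, ⟨[], f, rfl, _, h⟩, .singleton _⟩
    · rintro ⟨⟨j, hj⟩, ⟨t, g, hg, i, hi⟩, -⟩
      obtain ⟨rfl, rfl⟩ : t = [] ∧ g = f := by simpa [List.singleton_eq_append_iff] using hg
      grind
  | ih2 f y _ ih =>
    have e : (FreeSemigroup.of f * y).head :: (FreeSemigroup.of f * y).tail =
      f :: y.head :: y.tail := rfl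
    rw [e]
    simp only [wordSum_mul, Pi.add_apply, add_eq_pair_iff, wordSum_of, ih,
      FreeSemigroup.head_mul, FreeSemigroup.of_head, List.isChain_cons_cons, add_ne_zero_iff]
    constructor
    · rintro ⟨j, hf, ⟨k, hk⟩, ⟨t, g, ht, hg⟩, hc⟩
      exact ⟨⟨j, hf⟩, ⟨f :: t, g, by rw [ht]; rfl, hg⟩, ⟨p, j, k, hf, hk⟩, hc⟩
    · rintro ⟨⟨j, hj⟩, ⟨t, g, ht, hg⟩, ⟨p', j', k, hp, hk⟩, hc⟩
      -- The link between `f` and the head of `y` supplies the row index that the induction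
      -- hypothesis needs.
      obtain ⟨rfl, rfl⟩ : p = p' ∧ j = j' := by simpa [hj] using hp
      rcases t with _ | ⟨f', t⟩
      · simp at ht
      · exact ⟨j, hj, ⟨k, hk⟩, ⟨t, g, by simpa using (List.cons.inj ht).2, hg⟩, hc⟩

/-- The words over `Aff(B_n)` whose sum takes a given value at a given point. -/
def evalLanguage (a b : Brandt n) : Set (List (Aff (Brandt n))) :=
  {w | ∃ f t, w = f :: t ∧ wordSum ⟨f, t⟩ a = b}

@[simp] theorem cons_mem_evalLanguage {a b : Brandt n} {f : Aff (Brandt n)}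
    {t : List (Aff (Brandt n))} :
    f :: t ∈ evalLanguage a b ↔ wordSum ⟨f, t⟩ a = b := by
  constructor
  · rintro ⟨_, _, e, h⟩
    cases e
    exact h
  · exact fun h => ⟨f, t, rfl, h⟩

theorem isStarFree_evalLanguage_pair (a : Brandt n) (p q : Fin n) :
    IsStarFree (evalLanguage a (pair p q) : Language (Aff (Brandt n))) :=
  ((IsStarFree.head fun f : Aff (Brandt n) => ∃ j, f.1 a = pair p j).inter
    ((IsStarFree.last fun f : Aff (Brandt n) => ∃ i, f.1 a = pair i q).inter
      (IsStarFree.isChain fun f g : Aff (Brandt n) => f.1 a + g.1 a ≠ zero))).congr fun w => by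
    simp only [evalLanguage, wordSum_apply_eq_pair_iff, Set.mem_ofPred_eq]
    constructor
    · rintro ⟨⟨f, t, rfl, h⟩, h'⟩
      exact ⟨f, t, rfl, h, h'⟩
    · rintro ⟨f, t, rfl, h, h'⟩
      exact ⟨⟨f, t, rfl, h⟩, h'⟩

theorem isStarFree_evalLanguage (a b : Brandt n) :
    IsStarFree (evalLanguage a b : Language (Aff (Brandt n))) := by
  rcases b with _ | ⟨p, q⟩
  -- Complements are taken in `Σ*`, so the empty word must be removed.
  · refine (IsStarFree.nonempty.inter (IsStarFree.iUnion fun p : Fin n × Fin n =>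
      isStarFree_evalLanguage_pair a p.1 p.2).compl).congr fun w => ?_
    rcases w with _ | ⟨f, t⟩
    · simp [evalLanguage]
    · rcases h : wordSum ⟨f, t⟩ a <;> simp [h]
  · exact isStarFree_evalLanguage_pair a p q

/-- Any `P` works: there are finitely many maps and finitely many points at which to prescribe
values. -/
theorem isStarFree_toLanguage (P : Set (Brandt n → Brandt n)) :
    IsStarFree (toLanguage {x | wordSum x ∈ P}) := by
  refine (IsStarFree.inter IsStarFree.nonempty (IsStarFree.iUnion fun g : P =>
    IsStarFree.iInter fun a => isStarFree_evalLanguage a (g.1 a))).congr fun w => ?_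
  rcases w with _ | ⟨f, t⟩
  · simp [toLanguage]
  · simp only [evalLanguage, toLanguage, Set.mem_ofPred_eq]
    constructor
    · rintro ⟨-, ⟨g, hg⟩, h⟩
      refine ⟨⟨f, t⟩, ?_, rfl⟩
      convert hg
      ext a
      obtain ⟨_, _, e, h⟩ := h a
      cases e
      exact h
    · rintro ⟨⟨f', t'⟩, h, e⟩
      cases e
      exact ⟨by simp, ⟨_, h⟩, fun a => ⟨_, _, rfl, rfl⟩⟩

end Brandt

theorem theorem6 (n : ℕ) (hn : 2 ≤ n) :
    Nonempty (SyntacticSemigroup (Brandt.sumLanguage n hn) ≃*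
        Multiplicative (affineNearSemiringAdd (Brandt n))) ∧
      IsStarFree (toLanguage (Brandt.sumLanguage n hn)) :=
  ⟨⟨syntacticSemigroupEquiv Brandt.const_mem_Aff _ (Brandt.syntacticCon_sumLanguage_iff hn)⟩,
    Brandt.isStarFree_toLanguage _⟩
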